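/- **Model.** Let $K\ge 2$ be the number of arms, $T\in\mathbb N$ the horizon and $\varepsilon\in[0,1)$ the erasure probability. A *$K$-armed bandit instance* $\nu$ consists of $K$ probability distributions $\nu_1,\dots,\nu_K$ supported on $[0,1]$, with means $\mu_1,\dots,\mu_K$. In round $t=1,\dots,T$ a learner transmits an arm $a_t$ to an agent. Independently of everything else, the transmission is erased ($e_t=1$) with probability $\varepsilon$ and received ($e_t=0$) with probability $1-\varepsilon$. The agent then pulls $\tilde a_t=a_t$ if $e_t=0$, and $\tilde a_t=\tilde a_{t-1}$ if $e_t=1$; if the first transmission is erased, $\tilde a_1$ is drawn uniformly at random from the $K$ arms. A reward $r_t$ is drawn from $\nu_{\tilde a_t}$. A *policy* $\pi$ (with erasure feedback) chooses, possibly at random, the arm $a_t$ on the basis of the whole history $(a_s,e_s,\tilde a_s,r_s)_{s<t}$; it may depend on $K$, $T$ and $\varepsilon$, but not on $\nu$. The expected regret is $$\mathbb E[R_T(\pi,\nu)] = T\max_{1\le i\le K}\mu_i-\mathbb E\Big[\sum_{t=1}^T\mu_{\tilde a_t}\Big].$$ **Theorem.** There is a universal constant $c>0$ such that for all $\varepsilon\in[1/2,1)$,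 all $K>1$, all $T\ge \frac{K}{4(1-\varepsilon)}$ and every policy $\pi$, there is a $K$-armed bandit instance $\nu$ with $$\mathbb E[R_T(\pi,\nu)]\;\ge\; c\left(\sqrt{KT}+\frac{K}{1-\varepsilon}\right).$$ -/

import Mathlib

open MeasureTheory ProbabilityTheory

namespace ErasureBandit

noncomputable section

/-- A `K`-armed bandit instance: one reward distribution, supported on `[0, 1]`, per arm. -/
structure Instance (K : ℕ) where
  /-- the reward distribution of each arm -/
  law : Fin K → Measure ℝ
  isProbabilityMeasure_law : ∀ i, IsProbabilityMeasure (law i)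
  support_law : ∀ i, ∀ᵐ x ∂(law i), x ∈ Set.Icc (0 : ℝ) 1

/-- The mean reward of arm `i`. -/
def Instance.mean {K : ℕ} (ν : Instance K) (i : Fin K) : ℝ := ∫ x, x ∂(ν.law i)

/-- The reward distributions of an instance as a kernel from arms to rewards. -/
def Instance.kernel {K : ℕ} (ν : Instance K) : Kernel (Fin K) ℝ :=
  Kernel.ofFunOfCountable ν.law

instance {K : ℕ} (ν : Instance K) : IsMarkovKernel ν.kernel :=
  ⟨fun i => ν.isProbabilityMeasure_law i⟩

/-- What happens in one round, namely `(((aₜ, eₜ), ãₜ), rₜ)`: the arm transmitted by the learner, the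
erasure indicator (`true` if the transmission is erased), the arm actually pulled by the agent,
and the reward. -/
abbrev Round (K : ℕ) : Type := ((Fin K × Bool) × Fin K) × ℝ

/-- The arm transmitted by the learner in a round. -/
abbrev Round.sent {K : ℕ} (x : Round K) : Fin K := x.1.1.1

/-- The erasure indicator of a round. -/
abbrev Round.erased {K : ℕ} (x : Round K) : Bool := x.1.1.2

/-- The arm actually pulled by the agent in a round. -/
abbrev Round.pulled {K : ℕ} (x : Round K) : Fin K := x.1.2

/-- The reward obtained in a round. -/
abbrev Round.reward {K : ℕ} (x : Round K) : ℝ := x.2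

/-- The history of the first `t` rounds. -/
abbrev History (K t : ℕ) : Type := Fin t → Round K

/-- A (possibly randomized) policy of the learner with erasure feedback: in each round, given the
complete history of all previous rounds (the transmitted arms, the erasure indicators, the pulled
arms and the rewards), a probability distribution on the arms from which the arm to be transmitted
is drawn. -/
structure Policy (K : ℕ) where
  /-- the conditional law of the arm transmitted after `t` completed rounds -/
  choose : (t : ℕ) → Kernel (History K t) (Fin K)
  isMarkovKernel_choose : ∀ t, IsMarkovKernel (choose t)

instance {K : ℕ} (π : Policy K) (t : ℕ) : IsMarkovKernel (π.choose t) :=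
  π.isMarkovKernel_choose t

/-- The arm that the agent pulls if the current transmission is erased: the arm pulled in the
previous round, and in the first round an arm drawn uniformly at random. -/
def fallback (K : ℕ) : (t : ℕ) → Kernel (History K t) (Fin K)
  | 0 => Kernel.const _ (uniformOn Set.univ)
  | t + 1 => Kernel.deterministic (fun h => (h (Fin.last t)).pulled) (by fun_prop)

instance (K : ℕ) [NeZero K] (t : ℕ) : IsMarkovKernel (fallback K t) := by
  cases t with
  | zero =>
    have : IsProbabilityMeasure (uniformOn (Set.univ : Set (Fin K))) :=
      isProbabilityMeasure_uniformOn Set.finite_univ Set.univ_nonempty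
    unfold fallback
    infer_instance
  | succ t =>
    unfold fallback
    infer_instance

/-- The conditional law of the arm pulled by the agent, given the history, the transmitted arm and
the erasure indicator. -/
def agent (K t : ℕ) : Kernel (History K t × (Fin K × Bool)) (Fin K) :=
  Kernel.piecewise
    (s := {x : History K t × (Fin K × Bool) | x.2.2 = true})
    (measurableSet_eq_fun (by fun_prop) (by fun_prop))
    ((fallback K t).comap Prod.fst measurable_fst)
    (Kernel.deterministic (fun x => x.2.1) (by fun_prop))

instance (K : ℕ) [NeZero K] (t : ℕ) : IsMarkovKernel (agent K t) := by
  unfold agent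
  infer_instance

/-- The conditional law of round `t + 1` given the history of the first `t` rounds: the learner
transmits an arm drawn from its policy, the transmission is erased with probability `ε`
independently of everything else, the agent pulls the received arm or its fallback arm, and the
reward is drawn from the distribution of the pulled arm. -/
def roundKernel {K : ℕ} (ε : unitInterval) (π : Policy K) (ν : Instance K) (t : ℕ) :
    Kernel (History K t) (Round K) :=
  ((π.choose t ⊗ₖ Kernel.const _ (bernoulliMeasure true false ε)) ⊗ₖ agent K t) ⊗ₖ
    ν.kernel.comap (fun x : History K t × ((Fin K × Bool) × Fin K) => x.2.2) (by fun_prop)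

/-- The law of the history of the first `t` rounds when the policy `π` interacts with the instance
`ν` over the erasure channel with erasure probability `ε`. -/
def historyLaw {K : ℕ} (ε : unitInterval) (π : Policy K) (ν : Instance K) :
    (t : ℕ) → Measure (History K t)
  | 0 => Measure.dirac (fun i => i.elim0)
  | t + 1 => (historyLaw ε π ν t ⊗ₘ roundKernel ε π ν t).map
      (fun p => (Fin.snoc p.1 p.2 : History K (t + 1)))

/-- The expected regret `T * maxᵢ μᵢ - 𝔼[∑ₜ μ_{ãₜ}]` over `T` rounds. -/
def expectedRegret {K : ℕ} (ε : unitInterval) (π : Policy K) (ν : Instance K) (T : ℕ) : ℝ :=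
  T * (⨆ i, ν.mean i) - ∫ h, ∑ t, ν.mean (h t).pulled ∂(historyLaw ε π ν T)

end

end ErasureBandit

/-!
The two terms of the bound come from two families of instances, and the larger one suffices. Both
families are perturbations of `fairInstance K`, in which every reward is a fair coin flip: in
`bernoulliInstance (spike q i)` the coin of arm `i` has success probability `q > 1 / 2`. There the
regret is `q - 1 / 2` times the expected number of rounds in which arm `i` is not pulled
(`expectedRegret_spike`). The laws of the history are mutually comparable because the conditional
law of everything but the reward (`signalKernel`) does not depend on the instance, so the
likelihood ratio is a product of likelihood ratios of rewards (`historyLaw_bernoulliInstance`).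

For `√(K T)`, the erasures play no role. Some arm `i` is pulled at most `T / K` times on average
under `fairInstance K`. Taking `q = 1 / 2 + δ` with `δ` of order `√(K / T)`, the relative entropy of
the two laws of the history, `4 δ² T / K` up to constants, is small
(`integral_log_ratio_spike`, `coinDivergence_le`), so arm `i` is still missed in a constant
fraction of the rounds when it is the best arm (`integral_pulls_spike_le`). This costs `δ T`.

For `K / (1 - ε)`, restrict to the first `t ≈ K / (4 (1 - ε))` rounds, which is harmless since the
regret is monotone in the horizon (`expectedRegret_mono`). The agent can move to another arm only
when a transmission is received, so it sees at most `1 + t (1 - ε) ≤ 3 K / 4` arms on average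
(`lintegral_card_explored_le`). Hence some arm `i` is never pulled with probability at least
`1 / 4` under `fairInstance K`, and also under the instance with `q = 1`, as the two laws agree on
that event (`mul_measureReal_notMem_explored_le`). This costs `t / 8`.
-/

namespace ErasureBandit

open scoped ENNReal

variable {K : ℕ}

section HistoryLaw

/-! ### Integration against the law of the history -/

lemma measurable_snoc (t : ℕ) :
    Measurable (fun p : History K t × Round K => (Fin.snoc p.1 p.2 : History K (t + 1))) := by
  refine measurable_pi_iff.2 fun s => ?_
  induction s using Fin.lastCases with
  | last => simpa using measurable_snd
  | cast s =>
    simp only [Fin.snoc_castSucc]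
    fun_prop

instance (ε : unitInterval) [NeZero K] (π : Policy K) (ν : Instance K) (t : ℕ) :
    IsMarkovKernel (roundKernel ε π ν t) := by
  unfold roundKernel
  infer_instance

instance (ε : unitInterval) [NeZero K] (π : Policy K) (ν : Instance K) (t : ℕ) :
    IsProbabilityMeasure (historyLaw ε π ν t) := by
  induction t with
  | zero => unfold historyLaw; infer_instance
  | succ t ih =>
    unfold historyLaw
    exact Measure.isProbabilityMeasure_map (measurable_snoc t).aemeasurable

/-- The conditional law of the transmitted arm, the erasure indicator and the pulled arm of round
`t + 1`. Unlike the law of the reward, it does not depend on the bandit instance. -/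
noncomputable def signalKernel (ε : unitInterval) (π : Policy K) (t : ℕ) :
    Kernel (History K t) ((Fin K × Bool) × Fin K) :=
  (π.choose t ⊗ₖ Kernel.const _ (bernoulliMeasure true false ε)) ⊗ₖ agent K t

instance (ε : unitInterval) [NeZero K] (π : Policy K) (t : ℕ) :
    IsMarkovKernel (signalKernel ε π t) := by
  unfold signalKernel
  infer_instance

lemma lintegral_roundKernel (ε : unitInterval) (π : Policy K) (ν : Instance K) (t : ℕ)
    (h : History K t) {f : Round K → ℝ≥0∞} (hf : Measurable f) :
    ∫⁻ x, f x ∂(roundKernel ε π ν t h) =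
      ∫⁻ y, ∫⁻ r, f (y, r) ∂(ν.law y.2) ∂(signalKernel ε π t h) := by
  unfold roundKernel
  rw [Kernel.lintegral_compProd _ _ _ hf]
  rfl

lemma abs_sum_round_le {t : ℕ} {φ : Round K → ℝ} {C : ℝ} (hC : ∀ x, |φ x| ≤ C)
    (h : History K t) : |∑ s, φ (h s)| ≤ t * C := by
  refine (Finset.abs_sum_le_sum_abs _ _).trans ?_
  refine (Finset.sum_le_sum fun s _ => hC (h s)).trans ?_
  simp

lemma Instance.abs_mean_le (ν : Instance K) (i : Fin K) : |ν.mean i| ≤ 1 := by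
  have := ν.isProbabilityMeasure_law i
  have h := norm_integral_le_of_norm_le_const (μ := ν.law i) (f := fun x => x) (C := 1)
    ((ν.support_law i).mono fun x hx => by
      rw [Real.norm_eq_abs, abs_of_nonneg hx.1]; exact hx.2)
  simpa [Instance.mean] using h

variable (ε : unitInterval) [NeZero K] (π : Policy K) (ν : Instance K)

lemma lintegral_historyLaw_succ (t : ℕ) {f : History K (t + 1) → ℝ≥0∞} (hf : Measurable f) :
    ∫⁻ h, f h ∂(historyLaw ε π ν (t + 1)) =
      ∫⁻ h, ∫⁻ x, f (Fin.snoc h x) ∂(roundKernel ε π ν t h) ∂(historyLaw ε π ν t) := by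
  rw [historyLaw, lintegral_map hf (measurable_snoc t),
    Measure.lintegral_compProd (f := fun p => f (Fin.snoc p.1 p.2))
      (hf.comp (measurable_snoc t))]

lemma integrable_historyLaw_of_bound {t : ℕ} {f : History K t → ℝ} (hf : Measurable f) (C : ℝ)
    (hC : ∀ h, |f h| ≤ C) : Integrable f (historyLaw ε π ν t) :=
  Integrable.of_bound hf.aestronglyMeasurable C (ae_of_all _ hC)

lemma integrable_sum_historyLaw {t : ℕ} {φ : Round K → ℝ} (hφ : Measurable φ) {C : ℝ}
    (hC : ∀ x, |φ x| ≤ C) : Integrable (fun h => ∑ s, φ (h s)) (historyLaw ε π ν t) :=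
  integrable_historyLaw_of_bound ε π ν (by fun_prop) (t * C) (abs_sum_round_le hC)

/-- The expectation of an additive functional of the rounds increases in each round by the expected
conditional expectation of the new term. -/
lemma integral_sum_historyLaw_succ (t : ℕ) {φ : Round K → ℝ} (hφ : Measurable φ) {C : ℝ}
    (hC : ∀ x, |φ x| ≤ C) :
    ∫ h, ∑ s, φ (h s) ∂(historyLaw ε π ν (t + 1)) =
      ∫ h, ∑ s, φ (h s) ∂(historyLaw ε π ν t) +
        ∫ h, ∫ x, φ x ∂(roundKernel ε π ν t h) ∂(historyLaw ε π ν t) := by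
  have hφ' : ∀ h : History K t, Integrable φ (roundKernel ε π ν t h) := fun h =>
    Integrable.of_bound hφ.aestronglyMeasurable C (ae_of_all _ hC)
  have hm : Measurable fun h : History K (t + 1) => ∑ s, φ (h s) := by fun_prop
  rw [historyLaw, integral_map (measurable_snoc t).aemeasurable hm.aestronglyMeasurable,
    Measure.integral_compProd, ← integral_add]
  · refine integral_congr_ae (ae_of_all _ fun h => ?_)
    simp only [Fin.sum_univ_castSucc, Fin.snoc_castSucc, Fin.snoc_last]
    rw [integral_add (integrable_const _) (hφ' h)]
    simp
  · exact integrable_sum_historyLaw ε π ν hφ hC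
  · refine Integrable.of_bound (C := C) ?_ (ae_of_all _ fun h => ?_)
    · exact (hφ.stronglyMeasurable.integral_kernel).aestronglyMeasurable
    · refine (norm_integral_le_of_norm_le_const (ae_of_all _ hC)).trans ?_
      simp
  · exact Integrable.of_bound (hm.comp (measurable_snoc t)).aestronglyMeasurable
      ((t + 1 : ℕ) * C) (ae_of_all _ fun p => abs_sum_round_le hC _)

/-- An additive functional whose terms have mean zero under every reward law has mean zero. -/
lemma integral_sum_historyLaw_eq_zero (t : ℕ) {φ : Round K → ℝ} (hφ : Measurable φ) {C : ℝ}
    (hC : ∀ x, |φ x| ≤ C) (h0 : ∀ y, ∫ r, φ (y, r) ∂(ν.law y.2) = 0) :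
    ∫ h, ∑ s, φ (h s) ∂(historyLaw ε π ν t) = 0 := by
  induction t with
  | zero => simp
  | succ t ih =>
    rw [integral_sum_historyLaw_succ ε π ν t hφ hC, ih, zero_add]
    refine integral_eq_zero_of_ae (ae_of_all _ fun h => ?_)
    have hi : Integrable φ (roundKernel ε π ν t h) :=
      Integrable.of_bound hφ.aestronglyMeasurable C (ae_of_all _ hC)
    unfold roundKernel at hi
    change ∫ x, φ x ∂(roundKernel ε π ν t h) = 0
    unfold roundKernel
    rw [ProbabilityTheory.integral_compProd hi]
    exact integral_eq_zero_of_ae (ae_of_all _ fun y => h0 y)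

/-! ### Monotonicity of the regret in the horizon -/

lemma expectedRegret_eq_integral (t : ℕ) : expectedRegret ε π ν t =
    ∫ h, ∑ s : Fin t, ((⨆ i, ν.mean i) - ν.mean (h s).pulled) ∂(historyLaw ε π ν t) := by
  have hi := integrable_sum_historyLaw ε π ν (t := t) (φ := fun x => ν.mean x.pulled)
    (measurable_of_countable ν.mean |>.comp (by fun_prop)) (fun x => ν.abs_mean_le _)
  simp only [Finset.sum_sub_distrib]
  rw [integral_sub (integrable_const _) hi]
  simp [expectedRegret]

lemma expectedRegret_mono : Monotone (expectedRegret ε π ν) := by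
  refine monotone_nat_of_le_succ fun t => ?_
  rw [expectedRegret_eq_integral, expectedRegret_eq_integral]
  rw [integral_sum_historyLaw_succ ε π ν t (φ := fun x => (⨆ i, ν.mean i) - ν.mean x.pulled)
    (C := |⨆ i, ν.mean i| + 1)]
  · refine le_add_of_nonneg_right ?_
    refine integral_nonneg fun h => integral_nonneg fun x => ?_
    exact sub_nonneg.2 (le_ciSup (Set.finite_range _).bddAbove _)
  · exact measurable_const.sub (measurable_of_countable ν.mean |>.comp (by fun_prop))
  · intro x
    exact (abs_sub _ _).trans (add_le_add_right (ν.abs_mean_le _) _)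

end HistoryLaw

section Bernoulli

/-! ### Bernoulli instances and their likelihood ratios -/

/-- The instance in which arm `i` has Bernoulli rewards with success probability `p i`. -/
noncomputable def bernoulliInstance (p : Fin K → unitInterval) : Instance K where
  law i := bernoulliMeasure 1 0 (p i)
  isProbabilityMeasure_law _ := inferInstance
  support_law i := by
    rw [bernoulliMeasure_def, ae_add_measure_iff]
    constructor <;>
    · refine Measure.ae_smul_measure ?_ _
      exact (ae_dirac_iff measurableSet_Icc).2 (by simp)

@[simp]
lemma bernoulliInstance_law (p : Fin K → unitInterval) (i : Fin K) :
    (bernoulliInstance p).law i = bernoulliMeasure 1 0 (p i) := rfl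

@[simp]
lemma bernoulliInstance_mean (p : Fin K → unitInterval) (i : Fin K) :
    (bernoulliInstance p).mean i = p i := by
  simp [Instance.mean, integral_bernoulliMeasure]

/-- The success probability `1 / 2` of every arm of the reference instance. -/
noncomputable def half : unitInterval := ⟨1 / 2, by norm_num⟩

/-- The reference instance: every arm has fair coin flips as rewards. -/
noncomputable def fairInstance (K : ℕ) : Instance K := bernoulliInstance fun _ => half

/-- The likelihood ratio of a single round between `bernoulliInstance p` and `fairInstance K`.
Every reward other than `1` is treated as a failure, so that the ratio is bounded. -/
noncomputable def roundRatio (p : Fin K → unitInterval) (x : Round K) : ℝ :=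
  if x.reward = 1 then 2 * (p x.pulled : ℝ) else 2 * (1 - (p x.pulled : ℝ))

/-- The likelihood ratio of a history between `bernoulliInstance p` and `fairInstance K`. -/
noncomputable def ratio (p : Fin K → unitInterval) {t : ℕ} (h : History K t) : ℝ :=
  ∏ s, roundRatio p (h s)

lemma roundRatio_nonneg (p : Fin K → unitInterval) (x : Round K) : 0 ≤ roundRatio p x := by
  have := (p x.pulled).2.1
  have := (p x.pulled).2.2
  unfold roundRatio
  split_ifs <;> linarith

@[fun_prop]
lemma measurable_roundRatio (p : Fin K → unitInterval) : Measurable (roundRatio p) := by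
  have h : Measurable fun x : Round K => (p x.pulled : ℝ) :=
    (measurable_of_countable fun i => (p i : ℝ)).comp (by fun_prop)
  exact Measurable.ite (measurable_snd (measurableSet_singleton (1 : ℝ)))
    (h.const_mul 2) ((measurable_const.sub h).const_mul 2)

lemma ratio_nonneg (p : Fin K → unitInterval) {t : ℕ} (h : History K t) : 0 ≤ ratio p h :=
  Finset.prod_nonneg fun _ _ => roundRatio_nonneg _ _

@[fun_prop]
lemma measurable_ratio (p : Fin K → unitInterval) (t : ℕ) :
    Measurable (ratio p : History K t → ℝ) := by
  unfold ratio
  fun_prop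

lemma ratio_snoc (p : Fin K → unitInterval) {t : ℕ} (h : History K t) (x : Round K) :
    ratio p (Fin.snoc h x : History K (t + 1)) = ratio p h * roundRatio p x := by
  simp [ratio, Fin.prod_univ_castSucc]

lemma lintegral_bernoulliMeasure {X : Type*} [MeasurableSpace X] [MeasurableSingletonClass X]
    (x y : X) (q : unitInterval) (f : X → ℝ≥0∞) :
    ∫⁻ r, f r ∂(bernoulliMeasure x y q) =
      ENNReal.ofReal q * f x + ENNReal.ofReal (1 - q) * f y := by
  have h (q : unitInterval) : ENNReal.ofReal q = (unitInterval.toNNReal q : ℝ≥0∞) := by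
    rw [ENNReal.ofReal]
    congr
    exact Real.toNNReal_of_nonneg q.2.1
  rw [bernoulliMeasure_def, lintegral_add_measure, lintegral_smul_measure, lintegral_smul_measure,
    lintegral_dirac, lintegral_dirac, h, ← unitInterval.coe_symm_eq, h]
  rfl

lemma lintegral_bernoulliInstance_law (p : Fin K → unitInterval) (y : (Fin K × Bool) × Fin K)
    (f : Round K → ℝ≥0∞) :
    ∫⁻ r, f (y, r) ∂((bernoulliInstance p).law y.2) =
      ∫⁻ r, ENNReal.ofReal (roundRatio p (y, r)) * f (y, r) ∂((fairInstance K).law y.2) := by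
  have h (a : ℝ) (ha : 0 ≤ a) : ENNReal.ofReal (1 / 2) * ENNReal.ofReal (2 * a) =
      ENNReal.ofReal a := by
    rw [← ENNReal.ofReal_mul (by norm_num)]
    congr 1
    ring
  simp only [fairInstance, bernoulliInstance_law, lintegral_bernoulliMeasure, roundRatio, half,
    Round.reward, Round.pulled, if_true, zero_ne_one, if_false, ← mul_assoc]
  rw [h _ (p y.2).2.1, show (1 : ℝ) - 1 / 2 = 1 / 2 by norm_num,
    h _ (sub_nonneg.2 (p y.2).2.2)]

section ChangeOfMeasure

variable (ε : unitInterval) [NeZero K] (π : Policy K) (p : Fin K → unitInterval)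

/-- Change of measure: `ratio p` is the density of the law of the history under
`bernoulliInstance p` with respect to its law under `fairInstance K`. -/
lemma historyLaw_bernoulliInstance (t : ℕ) :
    historyLaw ε π (bernoulliInstance p) t =
      (historyLaw ε π (fairInstance K) t).withDensity fun h => ENNReal.ofReal (ratio p h) := by
  have key : ∀ f : History K t → ℝ≥0∞, Measurable f →
      ∫⁻ h, f h ∂(historyLaw ε π (bernoulliInstance p) t) =
        ∫⁻ h, ENNReal.ofReal (ratio p h) * f h ∂(historyLaw ε π (fairInstance K) t) := by
    induction t with
    | zero => intro f _; simp [historyLaw, ratio]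
    | succ t ih =>
      intro f hf
      have hsnoc : Measurable fun q : History K t × Round K =>
        f (Fin.snoc q.1 q.2) := hf.comp (measurable_snoc t)
      have hm (h : History K t) : Measurable fun x => f (Fin.snoc h x) :=
        hsnoc.comp measurable_prodMk_left
      rw [lintegral_historyLaw_succ ε π _ t hf, ih _ hsnoc.lintegral_kernel_prod_right',
        lintegral_historyLaw_succ ε π _ t (by fun_prop)]
      refine lintegral_congr fun h => ?_
      rw [lintegral_roundKernel ε π _ t h (hm h)]
      simp_rw [ratio_snoc, ENNReal.ofReal_mul (ratio_nonneg p h), mul_assoc]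
      have hm' : Measurable fun x => ENNReal.ofReal (roundRatio p x) * f (Fin.snoc h x) :=
        Measurable.mul (by fun_prop) (hm h)
      rw [lintegral_const_mul _ hm', lintegral_roundKernel ε π _ t h hm']
      congr 1
      exact lintegral_congr fun y =>
        lintegral_bernoulliInstance_law p y fun x => f (Fin.snoc h x)
  ext s hs
  rw [withDensity_apply _ hs, ← lintegral_indicator_one hs,
    key _ (measurable_one.indicator hs), ← lintegral_indicator hs]
  refine lintegral_congr fun h => ?_
  by_cases hh : h ∈ s <;> simp [hh]

lemma integral_bernoulliInstance {t : ℕ} (f : History K t → ℝ) :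
    ∫ h, f h ∂(historyLaw ε π (bernoulliInstance p) t) =
      ∫ h, ratio p h * f h ∂(historyLaw ε π (fairInstance K) t) := by
  rw [historyLaw_bernoulliInstance, integral_withDensity_eq_integral_toReal_smul (by fun_prop)
    (ae_of_all _ fun _ => ENNReal.ofReal_lt_top)]
  simp [ENNReal.toReal_ofReal (ratio_nonneg p _)]

end ChangeOfMeasure

/-! ### Instances with a single better arm -/

/-- The number of pulls of arm `i` in a history. -/
noncomputable def pulls (i : Fin K) {t : ℕ} (h : History K t) : ℝ :=
  ∑ s, if (h s).pulled = i then 1 else 0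

/-- The instance in which arm `i` has success probability `q` and every other arm `1 / 2`. -/
noncomputable def spike (q : unitInterval) (i : Fin K) : Fin K → unitInterval :=
  Function.update (fun _ => half) i q

lemma spike_apply (q : unitInterval) (i j : Fin K) :
    (spike q i j : ℝ) = 1 / 2 + ((q : ℝ) - 1 / 2) * if j = i then 1 else 0 := by
  by_cases hj : j = i
  · subst hj; simp [spike]
  · simp [spike, hj, half]

lemma measurable_pulled_eq (i : Fin K) :
    Measurable fun x : Round K => if x.pulled = i then (1 : ℝ) else 0 :=
  (measurable_of_countable fun j : Fin K => if j = i then (1 : ℝ) else 0).comp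
    (by fun_prop : Measurable fun x : Round K => x.pulled)

@[fun_prop]
lemma measurable_pulls (i : Fin K) (t : ℕ) : Measurable (pulls i : History K t → ℝ) := by
  unfold pulls
  exact Finset.measurable_sum _ fun s _ => (measurable_pulled_eq i).comp (measurable_pi_apply s)

lemma pulls_nonneg (i : Fin K) {t : ℕ} (h : History K t) : 0 ≤ pulls i h :=
  Finset.sum_nonneg fun _ _ => by positivity

lemma pulls_le (i : Fin K) {t : ℕ} (h : History K t) : pulls i h ≤ t := by
  refine (Finset.sum_le_card_nsmul _ _ 1 fun _ _ => ?_).trans (by simp)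
  split_ifs <;> simp

lemma sum_pulls {t : ℕ} (h : History K t) : ∑ i, pulls i h = t := by
  unfold pulls
  rw [Finset.sum_comm]
  simp

variable (ε : unitInterval) [NeZero K] (π : Policy K)

lemma integrable_pulls (ν : Instance K) (i : Fin K) (t : ℕ) :
    Integrable (pulls i) (historyLaw ε π ν t) :=
  integrable_historyLaw_of_bound ε π ν (by fun_prop) t fun h => by
    rw [abs_of_nonneg (pulls_nonneg i h)]; exact pulls_le i h

lemma expectedRegret_spike {q : unitInterval} (hq : 1 / 2 ≤ (q : ℝ)) (i : Fin K) (t : ℕ) :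
    expectedRegret ε π (bernoulliInstance (spike q i)) t =
      ((q : ℝ) - 1 / 2) *
        (t - ∫ h, pulls i h ∂(historyLaw ε π (bernoulliInstance (spike q i)) t)) := by
  have hsup : ⨆ j, (bernoulliInstance (spike q i)).mean j = q := by
    refine le_antisymm (ciSup_le fun j => ?_) ?_
    · rw [bernoulliInstance_mean, spike_apply]
      split_ifs <;> linarith
    · refine le_of_eq_of_le ?_ (le_ciSup (Set.finite_range _).bddAbove i)
      simp [spike]
  have hsum (h : History K t) :
      ∑ s, (bernoulliInstance (spike q i)).mean (h s).pulled =
        t * (1 / 2) + ((q : ℝ) - 1 / 2) * pulls i h := by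
    simp_rw [bernoulliInstance_mean, spike_apply, Finset.sum_add_distrib, ← Finset.mul_sum]
    simp [pulls]
  rw [expectedRegret, hsup]
  simp_rw [hsum]
  rw [integral_add (integrable_const _) ((integrable_pulls ε π _ i t).const_mul _),
    integral_const, integral_const_mul, probReal_univ, one_smul]
  ring

end Bernoulli

section Exploration

/-! ### The number of explored arms -/

/-- The set of arms pulled in a history. -/
def explored {t : ℕ} (h : History K t) : Finset (Fin K) :=
  Finset.univ.image fun s => (h s).pulled

lemma mem_explored {t : ℕ} {h : History K t} {i : Fin K} :
    i ∈ explored h ↔ ∃ s, (h s).pulled = i := by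
  simp [explored]

lemma measurable_comp_explored {β : Type*} [MeasurableSpace β] (g : Finset (Fin K) → β) (t : ℕ) :
    Measurable fun h : History K t => g (explored h) :=
  (measurable_of_countable fun a : Fin t → Fin K => g (Finset.univ.image a)).comp
    (by fun_prop : Measurable fun (h : History K t) s => (h s).pulled)

lemma explored_snoc {t : ℕ} (h : History K t) (x : Round K) :
    explored (Fin.snoc h x : History K (t + 1)) = insert x.pulled (explored h) := by
  ext i
  simp [mem_explored, Fin.exists_fin_succ', or_comm, eq_comm]

lemma card_explored_le {t : ℕ} (h : History K t) : (explored h).card ≤ t :=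
  Finset.card_image_le.trans (by simp)

variable (ε : unitInterval) [NeZero K] (π : Policy K) (ν : Instance K)

/-- An erased transmission makes the agent repeat the arm of the previous round, so an arm that
differs from it is pulled with probability at most `1 - ε`. -/
lemma lintegral_signalKernel_pulled_ne_le (t : ℕ) (h : History K (t + 1)) :
    ∫⁻ y, (if y.2 = (h (Fin.last t)).pulled then 0 else 1) ∂(signalKernel ε π (t + 1) h) ≤
      ENNReal.ofReal (1 - ε) := by
  have hag : ∀ b : Fin K × Bool, ∫⁻ j, (if j = (h (Fin.last t)).pulled then 0 else 1)
      ∂(agent K (t + 1) (h, b)) ≤ if b.2 = true then (0 : ℝ≥0∞) else 1 := by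
    rintro ⟨a, e⟩
    cases e
    · refine (lintegral_mono (g := fun _ => 1) fun j => ?_).trans (by simp)
      split_ifs <;> simp
    · simp [agent, Kernel.piecewise_apply, fallback, Kernel.comap_apply, Kernel.deterministic_apply]
  unfold signalKernel
  rw [Kernel.lintegral_compProd _ _ _ (measurable_of_countable _)]
  refine (lintegral_mono hag).trans ?_
  rw [Kernel.lintegral_compProd _ _ _ (measurable_of_countable _)]
  refine (lintegral_mono (g := fun _ => ENNReal.ofReal (1 - ε)) fun a => ?_).trans (by simp)
  rw [Kernel.const_apply, lintegral_bernoulliMeasure]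
  simp

lemma lintegral_card_explored_le (t : ℕ) :
    ∫⁻ h, ((explored h).card : ℝ≥0∞) ∂(historyLaw ε π ν t) ≤ 1 + t * ENNReal.ofReal (1 - ε) := by
  induction t with
  | zero => simp [explored]
  | succ t ih =>
    cases t with
    | zero =>
      refine (lintegral_mono (g := fun _ => 1) fun h => ?_).trans (by simp)
      exact (Nat.cast_le.2 (card_explored_le h)).trans_eq (by simp)
    | succ t =>
      rw [lintegral_historyLaw_succ ε π ν _ (measurable_comp_explored (fun s => (s.card : ℝ≥0∞)) _)]
      have hstep (h : History K (t + 1)) :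
          ∫⁻ x, ((explored (Fin.snoc h x : History K (t + 2))).card : ℝ≥0∞)
            ∂(roundKernel ε π ν (t + 1) h) ≤ (explored h).card + ENNReal.ofReal (1 - ε) := by
        have hm : Measurable fun x : Round K =>
            ((explored (Fin.snoc h x : History K (t + 2))).card : ℝ≥0∞) :=
          (measurable_comp_explored (fun s => (s.card : ℝ≥0∞)) _).comp
            ((measurable_snoc _).comp measurable_prodMk_left)
        rw [lintegral_roundKernel ε π ν _ h hm]
        have hr (y : (Fin K × Bool) × Fin K) :
            ∫⁻ r, ((explored (Fin.snoc h (y, r) : History K (t + 2))).card : ℝ≥0∞)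
              ∂(ν.law y.2) ≤
            (explored h).card + if y.2 = (h (Fin.last t)).pulled then 0 else 1 := by
          have := ν.isProbabilityMeasure_law y.2
          simp only [explored_snoc, Round.pulled, lintegral_const, measure_univ, mul_one]
          split_ifs with hy
          · rw [Finset.insert_eq_of_mem (mem_explored.2 ⟨Fin.last t, hy.symm⟩), add_zero]
          · exact_mod_cast Finset.card_insert_le _ _
        refine (lintegral_mono hr).trans ?_
        rw [lintegral_add_left measurable_const, lintegral_const, measure_univ, mul_one]
        gcongr
        exact lintegral_signalKernel_pulled_ne_le ε π t h
      refine (lintegral_mono hstep).trans ?_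
      rw [lintegral_add_right _ measurable_const, lintegral_const, measure_univ, mul_one]
      refine (add_le_add_left ih _).trans_eq ?_
      push_cast
      ring

lemma sum_measureReal_mem_explored_le (t : ℕ) :
    ∑ i, (historyLaw ε π ν t).real {h | i ∈ explored h} ≤ 1 + t * (1 - ε) := by
  have hε : 0 ≤ 1 - (ε : ℝ) := sub_nonneg.2 ε.2.2
  have hms (i : Fin K) : MeasurableSet {h : History K t | i ∈ explored h} :=
    measurable_comp_explored (fun s => i ∈ s) t |>.setOf
  have hsum : ∑ i, historyLaw ε π ν t {h | i ∈ explored h} =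
      ∫⁻ h, ((explored h).card : ℝ≥0∞) ∂(historyLaw ε π ν t) := by
    simp_rw [← lintegral_indicator_one (hms _)]
    rw [← lintegral_finsetSum _ fun i _ => measurable_one.indicator (hms i)]
    refine lintegral_congr fun h => ?_
    simp [Set.indicator_apply]
  have hle := hsum.trans_le (lintegral_card_explored_le ε π ν t)
  have := ENNReal.toReal_mono (by finiteness) hle
  rw [ENNReal.toReal_sum (fun i _ => measure_ne_top _ _), ENNReal.toReal_add (by simp)
    (by finiteness)] at this
  simpa [measureReal_def, ENNReal.toReal_ofReal hε] using this

end Exploration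

section Comparison

/-! ### Comparison of the number of pulls -/

lemma roundRatio_le (p : Fin K → unitInterval) (x : Round K) : roundRatio p x ≤ 2 := by
  have := (p x.pulled).2.1
  have := (p x.pulled).2.2
  unfold roundRatio
  split_ifs <;> linarith

lemma ratio_le (p : Fin K → unitInterval) {t : ℕ} (h : History K t) : ratio p h ≤ 2 ^ t :=
  (Finset.prod_le_prod (fun _ _ => roundRatio_nonneg p _) fun _ _ => roundRatio_le p _).trans_eq
    (by simp)

lemma roundRatio_spike_of_ne (q : unitInterval) {i : Fin K} {x : Round K} (hx : x.pulled ≠ i) :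
    roundRatio (spike q i) x = 1 := by
  simp only [roundRatio, spike_apply, hx]
  norm_num

/-- A pointwise substitute for Pinsker's inequality, to be integrated over a likelihood ratio `L`. It
combines `L - 1 - log L ≥ (√L - 1)²` with the inequality of arithmetic and geometric means for
`L - 1 = (√L - 1) (√L + 1)`. -/
lemma sub_one_le_of_pos {L : ℝ} (hL : 0 < L) :
    L - 1 ≤ 8 * (L - 1 - Real.log L) + (L + 1) / 16 := by
  obtain ⟨s, hs, rfl⟩ : ∃ s, 0 < s ∧ s ^ 2 = L := ⟨√L, Real.sqrt_pos.2 hL, Real.sq_sqrt hL.le⟩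
  have h1 := Real.log_le_sub_one_of_pos hs
  rw [Real.log_pow]
  push_cast
  nlinarith [sq_nonneg (16 * (s - 1) - (s + 1)), sq_nonneg (s - 1)]

variable (ε : unitInterval) [NeZero K] (π : Policy K) (q : unitInterval) (i : Fin K) (t : ℕ)

lemma integrable_ratio_mul {f : History K t → ℝ} (hf : Measurable f) {C : ℝ}
    (hC : ∀ h, |f h| ≤ C) (p : Fin K → unitInterval) (ν : Instance K) :
    Integrable (fun h => ratio p h * f h) (historyLaw ε π ν t) := by
  refine integrable_historyLaw_of_bound ε π ν (by fun_prop) (2 ^ t * C) fun h => ?_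
  rw [abs_mul, abs_of_nonneg (ratio_nonneg p h)]
  exact mul_le_mul (ratio_le p h) (hC h) (abs_nonneg _) (by positivity)

/-- The expected number of rounds in which arm `i` is missed under `bernoulliInstance (spike q i)` is
at least `t` times the probability that arm `i` is never pulled, and on this event the law of the
history is the same as under `fairInstance K`. -/
lemma mul_measureReal_notMem_explored_le :
    t * (1 - (historyLaw ε π (fairInstance K) t).real {h | i ∈ explored h}) ≤
      t - ∫ h, pulls i h ∂(historyLaw ε π (bernoulliInstance (spike q i)) t) := by
  have hms : MeasurableSet {h : History K t | i ∈ explored h} :=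
    measurable_comp_explored (fun s => i ∈ s) t |>.setOf
  have h1 : t - ∫ h, pulls i h ∂(historyLaw ε π (bernoulliInstance (spike q i)) t) =
      ∫ h, ratio (spike q i) h * (t - pulls i h) ∂(historyLaw ε π (fairInstance K) t) := by
    rw [← integral_bernoulliInstance, integral_sub (integrable_const _)
      (integrable_pulls ε π _ i t)]
    simp
  rw [h1, ← probReal_compl_eq_one_sub hms, mul_comm, ← smul_eq_mul,
    ← integral_indicator_const _ hms.compl]
  refine integral_mono ((integrable_const _).indicator hms.compl) ?_ fun h => ?_
  · refine integrable_ratio_mul ε π t (C := t) (by fun_prop) (fun h => ?_) _ _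
    rw [abs_of_nonneg (sub_nonneg.2 (pulls_le i h))]
    exact sub_le_self _ (pulls_nonneg i h)
  · by_cases hi : i ∈ explored h
    · simpa [hi] using mul_nonneg (ratio_nonneg _ h) (sub_nonneg.2 (pulls_le i h))
    · have hs : ∀ s, (h s).pulled ≠ i := by simpa [mem_explored] using hi
      simp [hi, ratio, pulls, hs, roundRatio_spike_of_ne q (hs _)]

/-- The relative entropy of a fair coin with respect to a coin with success probability `q`. -/
noncomputable def coinDivergence (q : unitInterval) : ℝ :=
  -(Real.log (2 * q) + Real.log (2 * (1 - q))) / 2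

/-- The divergence decomposition: the relative entropy between the laws of the history is the
expected number of pulls of arm `i` times the relative entropy between the two coins. -/
lemma integral_log_ratio_spike (hq0 : 0 < (q : ℝ)) (hq1 : (q : ℝ) < 1) :
    Integrable (fun h => -Real.log (ratio (spike q i) h))
      (historyLaw ε π (fairInstance K) t) ∧
    ∫ h, -Real.log (ratio (spike q i) h) ∂(historyLaw ε π (fairInstance K) t) =
      coinDivergence q * ∫ h, pulls i h ∂(historyLaw ε π (fairInstance K) t) := by
  have hpos (x : Round K) : 0 < roundRatio (spike q i) x := by
    unfold roundRatio
    rw [spike_apply]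
    split_ifs <;> linarith
  have hlog (x : Round K) : |Real.log (roundRatio (spike q i) x)| ≤
      |Real.log (2 * q)| + |Real.log (2 * (1 - q))| := by
    have := abs_nonneg (Real.log (2 * q))
    have := abs_nonneg (Real.log (2 * (1 - q)))
    by_cases hx : x.pulled = i
    · have hs : spike q i x.pulled = q := by rw [hx]; simp [spike]
      unfold roundRatio
      rw [hs]
      split_ifs <;> linarith
    · rw [roundRatio_spike_of_ne q hx, Real.log_one, abs_zero]
      linarith
  have h0 := integral_sum_historyLaw_eq_zero ε π (fairInstance K) t
    (φ := fun x => -Real.log (roundRatio (spike q i) x) -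
      coinDivergence q * if x.pulled = i then 1 else 0)
    (C := |Real.log (2 * q)| + |Real.log (2 * (1 - q))| + |coinDivergence q|)
    ((Real.measurable_log.comp (measurable_roundRatio _)).neg.sub
      ((measurable_pulled_eq i).const_mul _))
    (fun x => by
      refine (abs_sub _ _).trans (add_le_add ((abs_neg _).trans_le (hlog x)) ?_)
      split_ifs <;> simp)
    (fun y => by
      simp only [fairInstance, bernoulliInstance_law, integral_bernoulliMeasure]
      by_cases hy : y.2 = i
      · simp [roundRatio, Round.reward, Round.pulled, hy, spike, half, coinDivergence]
        ring
      · simp [roundRatio, Round.reward, Round.pulled, hy, spike, half]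
        norm_num)
  have hsum (h : History K t) : ∑ s, (-Real.log (roundRatio (spike q i) (h s)) -
      coinDivergence q * if (h s).pulled = i then 1 else 0) =
      -Real.log (ratio (spike q i) h) - coinDivergence q * pulls i h := by
    rw [ratio, Real.log_prod fun s _ => (hpos (h s)).ne', Finset.sum_sub_distrib, ← Finset.mul_sum,
      Finset.sum_neg_distrib, pulls]
  have hint : Integrable (fun h => -Real.log (ratio (spike q i) h))
      (historyLaw ε π (fairInstance K) t) := by
    have := integrable_sum_historyLaw ε π (fairInstance K) (t := t)
      (Real.measurable_log.comp (measurable_roundRatio (spike q i))) hlog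
    refine this.neg.congr (ae_of_all _ fun h => ?_)
    simp [ratio, Real.log_prod fun s _ => (hpos (h s)).ne']
  simp_rw [hsum] at h0
  rw [integral_sub hint ((integrable_pulls ε π _ i t).const_mul _), integral_const_mul] at h0
  exact ⟨hint, sub_eq_zero.1 h0⟩

/-- Information bound: improving arm `i` raises its expected number of pulls by little, unless it
was pulled often when all arms were fair. -/
lemma integral_pulls_spike_le (hq0 : 0 < (q : ℝ)) (hq1 : (q : ℝ) < 1) :
    ∫ h, pulls i h ∂(historyLaw ε π (bernoulliInstance (spike q i)) t) ≤
      ∫ h, pulls i h ∂(historyLaw ε π (fairInstance K) t) +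
        t * (8 * (coinDivergence q * ∫ h, pulls i h ∂(historyLaw ε π (fairInstance K) t)) +
          1 / 8) := by
  obtain ⟨hlog, hdiv⟩ := integral_log_ratio_spike ε π q i t hq0 hq1
  have hpos (h : History K t) : 0 < ratio (spike q i) h := by
    refine Finset.prod_pos fun s _ => ?_
    unfold roundRatio
    rw [spike_apply]
    split_ifs <;> linarith
  have hR : Integrable (fun h => ratio (spike q i) h) (historyLaw ε π (fairInstance K) t) := by
    simpa using integrable_ratio_mul ε π t (f := fun _ => 1) measurable_const (C := 1) (by simp)
      (spike q i) (fairInstance K)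
  have hR1 : ∫ h, ratio (spike q i) h ∂(historyLaw ε π (fairInstance K) t) = 1 := by
    simpa using (integral_bernoulliInstance ε π (spike q i) (t := t) fun _ => 1).symm
  have hP := integrable_pulls ε π (fairInstance K) i t
  have hR2 : Integrable (fun h => ratio (spike q i) h - 1) (historyLaw ε π (fairInstance K) t) :=
    hR.sub (integrable_const 1)
  have hA : Integrable (fun h => ratio (spike q i) h - 1 + -Real.log (ratio (spike q i) h))
      (historyLaw ε π (fairInstance K) t) := hR2.add hlog
  have hB : Integrable (fun h => (ratio (spike q i) h + 1) / 16)
      (historyLaw ε π (fairInstance K) t) := (hR.add (integrable_const 1)).div_const 16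
  have hAB : Integrable (fun h => 8 * (ratio (spike q i) h - 1 + -Real.log (ratio (spike q i) h)) +
      (ratio (spike q i) h + 1) / 16) (historyLaw ε π (fairInstance K) t) :=
    (hA.const_mul 8).add hB
  rw [integral_bernoulliInstance]
  calc ∫ h, ratio (spike q i) h * pulls i h ∂(historyLaw ε π (fairInstance K) t)
      ≤ ∫ h, (pulls i h + t * (8 * (ratio (spike q i) h - 1 + -Real.log (ratio (spike q i) h)) +
          (ratio (spike q i) h + 1) / 16)) ∂(historyLaw ε π (fairInstance K) t) := by
        refine integral_mono (integrable_ratio_mul ε π t (C := t) (by fun_prop) (fun h => ?_) _ _)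
          (hP.add (hAB.const_mul _)) fun h => ?_
        · rw [abs_of_nonneg (pulls_nonneg i h)]
          exact pulls_le i h
        · have h1 := sub_one_le_of_pos (hpos h)
          have h2 := Real.log_le_sub_one_of_pos (hpos h)
          have h3 := hpos h
          have h4 := mul_le_mul_of_nonneg_left h1 (pulls_nonneg i h)
          have h5 := mul_le_mul_of_nonneg_right (pulls_le i h)
            (by linarith : 0 ≤ 8 * (ratio (spike q i) h - 1 - Real.log (ratio (spike q i) h)) +
              (ratio (spike q i) h + 1) / 16)
          simp only
          rw [← sub_eq_add_neg]
          linarith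
    _ = _ := by
        rw [integral_add hP (hAB.const_mul _), integral_const_mul,
          integral_add (hA.const_mul 8) hB, integral_const_mul, integral_div,
          integral_add hR2 hlog, integral_sub hR (integrable_const 1),
          integral_add hR (integrable_const 1), hdiv, hR1,
          integral_const, probReal_univ, one_smul]
        ring

lemma coinDivergence_le {δ : ℝ} (hq : (q : ℝ) = 1 / 2 + δ) (hδ : δ ^ 2 ≤ 1 / 8) :
    coinDivergence q ≤ 4 * δ ^ 2 := by
  have hδ2 := abs_lt_of_sq_lt_sq (a := δ) (b := 1 / 2) (by linarith) (by norm_num)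
  rw [abs_lt] at hδ2
  have h1 : 0 < 1 - 4 * δ ^ 2 := by linarith
  have h2 : Real.log (2 * q) + Real.log (2 * (1 - q)) = Real.log (1 - 4 * δ ^ 2) := by
    rw [← Real.log_mul (by rw [hq]; linarith) (by rw [hq]; linarith), hq]
    congr 1
    ring
  have h3 := Real.one_sub_inv_le_log_of_pos h1
  have h4 : (1 - 4 * δ ^ 2)⁻¹ ≤ 1 + 8 * δ ^ 2 := by
    rw [inv_le_iff_one_le_mul₀ h1]
    nlinarith [sq_nonneg δ]
  rw [coinDivergence, h2]
  linarith

end Comparison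

/-! ### The two lower bounds -/

/-- The information-theoretic lower bound. -/
lemma exists_sqrt_mul_le_expectedRegret (ε : unitInterval) (π : Policy K) {T : ℕ} (hK : 1 < K)
    (hT : (K : ℝ) ≤ 2 * T) :
    ∃ ν : Instance K, √((K : ℝ) * T) / 64 ≤ expectedRegret ε π ν T := by
  have : NeZero K := ⟨by omega⟩
  have hK2 : (2 : ℝ) ≤ K := by exact_mod_cast hK
  have hT0 : (0 : ℝ) < T := by linarith
  -- This is `√(K / T) / 16`, the gap at which `T / K` pulls carry a bounded amount of information.
  set δ : ℝ := √((K : ℝ) * T) / (16 * T) with hδ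
  have hsq : √((K : ℝ) * T) ^ 2 = K * T := Real.sq_sqrt (by positivity)
  have hδ0 : 0 < δ := by positivity
  have hδsq : δ ^ 2 * (256 * T) = K := by
    rw [hδ, div_pow, hsq]
    field_simp
    norm_num
  have hδ2 : δ ^ 2 ≤ 1 / 128 := by
    by_contra! hc
    nlinarith
  have hδ1 : δ < 1 / 2 := by nlinarith
  let q : unitInterval := ⟨1 / 2 + δ, by linarith, by linarith⟩
  have hq : (q : ℝ) = 1 / 2 + δ := rfl
  -- An arm that the policy pulls at most `T / K` times on average when all arms are fair.
  obtain ⟨i, -, hi⟩ : ∃ i ∈ (Finset.univ : Finset (Fin K)),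
      ∫ h, pulls i h ∂(historyLaw ε π (fairInstance K) T) ≤ T / K := by
    refine Finset.exists_le_of_sum_le Finset.univ_nonempty ?_
    rw [← integral_finsetSum _ fun i _ => integrable_pulls ε π _ i T]
    simp only [sum_pulls]
    simp
    field_simp
    rfl
  refine ⟨bernoulliInstance (spike q i), ?_⟩
  rw [expectedRegret_spike ε π (by rw [hq]; linarith)]
  have h1 := integral_pulls_spike_le ε π q i T (by rw [hq]; linarith) (by rw [hq]; linarith)
  have h2 := coinDivergence_le q hq (by linarith)
  set N := ∫ h, pulls i h ∂(historyLaw ε π (fairInstance K) T) with hN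
  have hN0 : 0 ≤ N := integral_nonneg fun h => pulls_nonneg i h
  have h3 : coinDivergence q * N ≤ 1 / 64 := by
    calc coinDivergence q * N ≤ 4 * δ ^ 2 * (T / K) := by gcongr
      _ = 1 / 64 := by
        rw [← hδsq]
        field_simp
        norm_num
  have h4 : N ≤ T / 2 := hi.trans (by gcongr)
  have h5 : T * (8 * (coinDivergence q * N) + 1 / 8) ≤ (T : ℝ) * (1 / 4) := by
    gcongr
    linarith
  calc √((K : ℝ) * T) / 64 = δ * (T / 4) := by rw [hδ]; field_simp; norm_num
    _ ≤ _ := by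
      rw [hq, add_sub_cancel_left]
      gcongr
      linarith

/-- The exploration lower bound: only about `(1 - ε) t` transmissions get through in `t` rounds. -/
lemma exists_div_one_sub_le_expectedRegret {ε : unitInterval} (π : Policy K) {T : ℕ} (hK : 1 < K)
    (hε : 1 / 2 ≤ (ε : ℝ)) (hε1 : (ε : ℝ) < 1) (hT : (K : ℝ) / (4 * (1 - ε)) ≤ T) :
    ∃ ν : Instance K, (K : ℝ) / (1 - ε) / 64 ≤ expectedRegret ε π ν T := by
  have : NeZero K := ⟨by omega⟩
  have hK2 : (2 : ℝ) ≤ K := by exact_mod_cast hK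
  have hε' : 0 < 1 - (ε : ℝ) := by linarith
  set x := (K : ℝ) / (4 * (1 - ε)) with hx
  have hx1 : 1 ≤ x := by
    rw [hx, le_div_iff₀ (by linarith)]
    linarith
  have hxK : x * (1 - ε) = K / 4 := by
    rw [hx]
    field_simp
  -- During the first `⌊x⌋₊` rounds the expected number of explored arms is at most
  -- `1 + K / 4 ≤ 3 * K / 4`.
  have ht : (⌊x⌋₊ : ℝ) ≤ x := Nat.floor_le (by linarith)
  have ht2 : x / 2 ≤ ⌊x⌋₊ := by
    have h1 : (1 : ℝ) ≤ ⌊x⌋₊ := by exact_mod_cast (Nat.one_le_floor_iff x).2 hx1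
    linarith [Nat.lt_floor_add_one x]
  -- An arm that the policy finds with probability at most `3 / 4` within `⌊x⌋₊` rounds.
  obtain ⟨i, -, hi⟩ : ∃ i ∈ (Finset.univ : Finset (Fin K)),
      (historyLaw ε π (fairInstance K) ⌊x⌋₊).real {h | i ∈ explored h} ≤ 3 / 4 := by
    refine Finset.exists_le_of_sum_le Finset.univ_nonempty ?_
    refine (sum_measureReal_mem_explored_le ε π _ _).trans ?_
    have := mul_le_mul_of_nonneg_right ht hε'.le
    simp
    linarith
  refine ⟨bernoulliInstance (spike 1 i), ?_⟩
  refine le_trans ?_ (expectedRegret_mono ε π _ (Nat.floor_le_of_le hT))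
  rw [expectedRegret_spike ε π (by norm_num)]
  have h1 := mul_measureReal_notMem_explored_le ε π 1 i ⌊x⌋₊
  have h2 : (⌊x⌋₊ : ℝ) * (1 / 4) ≤
      ⌊x⌋₊ * (1 - (historyLaw ε π (fairInstance K) ⌊x⌋₊).real {h | i ∈ explored h}) := by
    gcongr
    linarith
  have h3 : K / (1 - (ε : ℝ)) / 64 = x / 16 := by
    rw [hx]
    field_simp
    norm_num
  rw [h3, Set.Icc.coe_one]
  linarith

end ErasureBandit

theorem theorem1 :
    ∃ c : ℝ, 0 < c ∧
      ∀ (K T : ℕ) (ε : unitInterval), 1 < K → 1 / 2 ≤ (ε : ℝ) → (ε : ℝ) < 1 →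
        (K : ℝ) / (4 * (1 - (ε : ℝ))) ≤ (T : ℝ) →
        ∀ π : ErasureBandit.Policy K, ∃ ν : ErasureBandit.Instance K,
          c * (Real.sqrt ((K : ℝ) * (T : ℝ)) + (K : ℝ) / (1 - (ε : ℝ))) ≤
            ErasureBandit.expectedRegret ε π ν T := by
  refine ⟨1 / 128, by norm_num, fun K T ε hK hε hε1 hT π => ?_⟩
  have hKT : (K : ℝ) ≤ 2 * T := by
    rw [div_le_iff₀ (by linarith)] at hT
    nlinarith [(Nat.cast_nonneg T : (0 : ℝ) ≤ T)]
  obtain ⟨ν₁, h₁⟩ := ErasureBandit.exists_sqrt_mul_le_expectedRegret ε π hK hKT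
  obtain ⟨ν₂, h₂⟩ := ErasureBandit.exists_div_one_sub_le_expectedRegret π hK hε hε1 hT
  rcases le_total (Real.sqrt ((K : ℝ) * T)) (K / (1 - (ε : ℝ))) with h | h
  · exact ⟨ν₂, by linarith⟩
  · exact ⟨ν₁, by linarith⟩
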